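/- Let $K$ be a number field, let $\phi(x)=x^n+a_{n-1}x^{n-1}+\dots+a_0\in K[x]$ be monic of degree $n\ge 2$, and let $\nu$ be the (additive) valuation at a non-archimedean place of $K$. Let $\mathbb{C}_\nu$ be the completion of an algebraic closure of $K_\nu$. Let $\mathsf{A}^1$ be the Berkovich affine line over $\mathbb{C}_\nu$, i.e. the set of multiplicative seminorms $\zeta=[\cdot]_\zeta$ on $\mathbb{C}_\nu[x]$ extending the absolute value of $\mathbb{C}_\nu$, with the coarsest topology making $\zeta\mapsto[f]_\zeta$ continuous for all $f\in\mathbb{C}_\nu[x]$, and let $\mathsf{P}^1=\mathsf{A}^1\cup\{\infty\}$ be the Berkovich projective line, the one-point compactification of $\mathsf{A}^1$. The polynomial $\phi$ acts on $\mathsf{P}^1$ by $[f]_{\phi(\zeta)}=[f\circ\phi]_\zeta$ and $\phi(\infty)=\infty$. The Fatou set of $\phi$ is the largest open subset of $\mathsf{P}^1$ on which the family of iterates $\{\phi^m\}_{m\ge1}$ is equicontinuous (for the unique uniform structure of the compact Hausdorff space $\mathsf{P}^1$), and the Julia set $J(\phi)$ is its complement. Let $D=\{\zeta\in\mathsf{A}^1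 : [x]_\zeta<1\}$ be the Berkovich open unit disk. Suppose that $\nu(a_0)\le 0$ and $\nu(a_0)<\nu(a_i)$ for all $1\le i\le n-1$. Then $J(\phi)\cap D=\emptyset$. If moreover $\nu(a_0)<0$, then $D$ is contained in the basin of attraction of $\infty$, i.e. $\phi^m(\zeta)\to\infty$ in $\mathsf{P}^1$ as $m\to\infty$ for every $\zeta\in D$. -/

import Mathlib

open Polynomial IsDedekindDomain Filter Topology
open scoped NumberField OnePoint

noncomputable section

/-! ### The Berkovich projective line over a normed field -/

/-- A point of the Berkovich affine line over `F`: a multiplicative seminorm on `F[T]` which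
extends the absolute value of `F`. -/
@[ext]
structure BerkovichAffineLine (F : Type*) [NormedField F] where
  /-- the seminorm `f ↦ [f]_ζ` -/
  seminorm : MulRingSeminorm F[X]
  map_C : ∀ a : F, seminorm (C a) = ‖a‖

namespace BerkovichAffineLine

variable {F : Type*} [NormedField F]

/-- The coarsest topology for which `ζ ↦ [f]_ζ` is continuous for every polynomial `f`. -/
instance instTopologicalSpace : TopologicalSpace (BerkovichAffineLine F) :=
  TopologicalSpace.induced (fun ζ (f : F[X]) => ζ.seminorm f) inferInstance

/-- The absolute value `|ζ| = [T]_ζ`. -/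
def abs (ζ : BerkovichAffineLine F) : ℝ := ζ.seminorm X

/-- The action of a polynomial `φ` on the Berkovich affine line: `[f]_{φ(ζ)} = [f ∘ φ]_ζ`. -/
def map (φ : F[X]) (ζ : BerkovichAffineLine F) : BerkovichAffineLine F where
  seminorm :=
    { toFun := fun f => ζ.seminorm (f.comp φ)
      map_zero' := by simp
      add_le' := fun f g => by simpa using map_add_le_add ζ.seminorm (f.comp φ) (g.comp φ)
      neg' := fun f => by simp
      map_one' := by simp
      map_mul' := fun f g => by simp }
  map_C := fun a => by
    change ζ.seminorm ((C a).comp φ) = ‖a‖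
    simpa using ζ.map_C a

theorem isEmbedding_seminorm :
    IsEmbedding (fun (ζ : BerkovichAffineLine F) (f : F[X]) => ζ.seminorm f) :=
  ⟨⟨rfl⟩, fun _ _ h => BerkovichAffineLine.ext (DFunLike.coe_injective h)⟩

theorem continuous_seminorm (f : F[X]) :
    Continuous fun ζ : BerkovichAffineLine F => ζ.seminorm f :=
  (continuous_apply f).comp isEmbedding_seminorm.continuous

instance instT2Space : T2Space (BerkovichAffineLine F) := isEmbedding_seminorm.t2Space

theorem seminorm_le (ζ : BerkovichAffineLine F) {R : ℝ} (hR : ζ.abs ≤ R) (f : F[X]) :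
    ζ.seminorm f ≤ ∑ i ∈ f.support, ‖f.coeff i‖ * R ^ i := by
  have h0 : 0 ≤ ζ.abs := apply_nonneg ζ.seminorm X
  have hsum : ζ.seminorm (∑ i ∈ f.support, C (f.coeff i) * X ^ i) ≤
      ∑ i ∈ f.support, ζ.seminorm (C (f.coeff i) * X ^ i) :=
    Finset.le_sum_of_subadditive _ (map_zero _).le (fun a b => map_add_le_add _ a b) _ _
  rw [← f.as_sum_support_C_mul_X_pow] at hsum
  refine hsum.trans (Finset.sum_le_sum fun i _ => ?_)
  rw [map_mul, map_pow, ζ.map_C]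
  exact mul_le_mul_of_nonneg_left (pow_le_pow_left₀ h0 hR i) (norm_nonneg _)

theorem isClosedEmbedding_seminorm :
    IsClosedEmbedding (fun (ζ : BerkovichAffineLine F) (f : F[X]) => ζ.seminorm f) := by
  refine ⟨isEmbedding_seminorm, ?_⟩
  have hrange : Set.range (fun (ζ : BerkovichAffineLine F) (f : F[X]) => ζ.seminorm f) =
      {g | g 0 = 0} ∩ {g | ∀ p q, g (p + q) ≤ g p + g q} ∩ {g | ∀ p, g (-p) = g p} ∩
        {g | g 1 = 1} ∩ {g | ∀ p q, g (p * q) = g p * g q} ∩ {g | ∀ a, g (C a) = ‖a‖} := by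
    ext g
    constructor
    · rintro ⟨ζ, rfl⟩
      exact ⟨⟨⟨⟨⟨map_zero _, fun p q => map_add_le_add _ p q⟩, fun p => map_neg_eq_map _ p⟩,
        map_one _⟩, fun p q => map_mul _ p q⟩, ζ.map_C⟩
    · rintro ⟨⟨⟨⟨⟨h0, hadd⟩, hneg⟩, h1⟩, hmul⟩, hC⟩
      let N : MulRingSeminorm F[X] :=
        { toFun := g
          map_zero' := h0
          add_le' := hadd
          neg' := hneg
          map_one' := h1
          map_mul' := hmul }
      exact ⟨⟨N, hC⟩, rfl⟩
  rw [hrange]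
  have hc (p : F[X]) : Continuous fun g : F[X] → ℝ => g p := continuous_apply p
  refine ((((IsClosed.inter ?_ ?_).inter ?_).inter ?_).inter ?_).inter ?_
  · exact isClosed_eq (hc 0) continuous_const
  · simp only [Set.ofPred_forall]
    exact isClosed_iInter fun p => isClosed_iInter fun q =>
      isClosed_le (hc _) ((hc p).add (hc q))
  · simp only [Set.ofPred_forall]
    exact isClosed_iInter fun p => isClosed_eq (hc _) (hc p)
  · exact isClosed_eq (hc 1) continuous_const
  · simp only [Set.ofPred_forall]
    exact isClosed_iInter fun p => isClosed_iInter fun q =>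
      isClosed_eq (hc _) ((hc p).mul (hc q))
  · simp only [Set.ofPred_forall]
    exact isClosed_iInter fun a => isClosed_eq (hc _) continuous_const

theorem isCompact_abs_le (R : ℝ) : IsCompact {ζ : BerkovichAffineLine F | ζ.abs ≤ R} := by
  have hK : IsCompact (Set.univ.pi fun f : F[X] =>
      Set.Icc (0 : ℝ) (∑ i ∈ f.support, ‖f.coeff i‖ * R ^ i)) :=
    isCompact_univ_pi fun _ => isCompact_Icc
  refine (isClosedEmbedding_seminorm.isCompact_preimage hK).of_isClosed_subset
    (isClosed_le (continuous_seminorm X) continuous_const) fun ζ hζ f _ => ?_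
  exact ⟨apply_nonneg ζ.seminorm f, ζ.seminorm_le hζ f⟩

instance instWeaklyLocallyCompactSpace : WeaklyLocallyCompactSpace (BerkovichAffineLine F) where
  exists_compact_mem_nhds ζ :=
    ⟨{ξ | ξ.abs ≤ ζ.abs + 1}, isCompact_abs_le _,
      mem_of_superset ((isOpen_lt (continuous_seminorm X) continuous_const).mem_nhds
        (lt_add_one ζ.abs)) fun ξ (h : ξ.abs < ζ.abs + 1) =>
          show ξ.abs ≤ ζ.abs + 1 from h.le⟩

end BerkovichAffineLine

/-- The Berkovich projective line over `F`, the one-point compactification of the Berkovich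
affine line. -/
abbrev BerkovichProjectiveLine (F : Type*) [NormedField F] : Type _ :=
  OnePoint (BerkovichAffineLine F)

namespace BerkovichProjectiveLine

variable {F : Type*} [NormedField F]

/-- The action of a (non-constant) polynomial on the Berkovich projective line; it fixes `∞`. -/
def map (φ : F[X]) : BerkovichProjectiveLine F → BerkovichProjectiveLine F :=
  OnePoint.map (BerkovichAffineLine.map φ)

variable (F) in
/-- The Berkovich open unit disk `{ζ : |ζ| < 1}`. -/
def openUnitDisk : Set (BerkovichProjectiveLine F) :=
  (fun ζ : BerkovichAffineLine F => (ζ : BerkovichProjectiveLine F)) '' {ζ | ζ.abs < 1}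

/-- The unique uniform structure which induces the compact Hausdorff topology of the Berkovich
projective line. -/
instance instUniformSpace : UniformSpace (BerkovichProjectiveLine F) := uniformSpaceOfCompactR1

/-- The Fatou set: the largest open set on which the family of iterates `φ, φ², φ³, …` is
equicontinuous. -/
def fatouSet (φ : F[X]) : Set (BerkovichProjectiveLine F) :=
  ⋃₀ {U | IsOpen U ∧ EquicontinuousOn (fun m : ℕ => (map φ)^[m + 1]) U}

/-- The Julia set: the complement of the Fatou set. -/
def juliaSet (φ : F[X]) : Set (BerkovichProjectiveLine F) := (fatouSet φ)ᶜ

/-- The basin of attraction of `∞`: the points whose iterates converge to `∞`. -/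
def basinOfInfinity (φ : F[X]) : Set (BerkovichProjectiveLine F) :=
  {ζ | Tendsto (fun m : ℕ => (map φ)^[m] ζ) atTop (𝓝 ∞)}

end BerkovichProjectiveLine

/-! ### The field `ℂ_ν` at a finite place of a number field -/

namespace FinitePlaceComplex

variable {K : Type*} [Field K] [NumberField K] (v : HeightOneSpectrum (𝓞 K))

instance instNontriviallyNormedFieldCompletion : NontriviallyNormedField (v.adicCompletion K) :=
  Valued.toNontriviallyNormedField _ (WithZero (Multiplicative ℤ))

/-- An algebraic closure of the completion `K_ν`. -/
abbrev AlgCl : Type _ := AlgebraicClosure (v.adicCompletion K)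

/-- The unique extension to the algebraic closure of the absolute value of `K_ν`. -/
instance instNormedFieldAlgCl : NormedField (AlgCl v) := spectralNorm.normedField (v.adicCompletion K) (AlgCl v)

/-- The field `ℂ_ν`, the completion of the algebraic closure of `K_ν`. -/
abbrev Cv : Type _ := UniformSpace.Completion (AlgCl v)

/-- The embedding of `K` in `ℂ_ν`. -/
def embedding : K →+* Cv v :=
  UniformSpace.Completion.coeRingHom.comp
    ((algebraMap (v.adicCompletion K) (AlgCl v)).comp (algebraMap K (v.adicCompletion K)))

end FinitePlaceComplex

end

/-! ### Seminorm estimates and a criterion for equicontinuity -/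

namespace BerkovichAffineLine

variable {F : Type*} [NormedField F]

/-! The two cases `ν(a₀) < 0` and `ν(a₀) = 0` have different mechanisms.

If `|a₀| > 1`, the constant term strictly dominates on the open unit disk, so one step sends every
point of `D` to absolute value `|a₀|`. From there on the leading term dominates and `|φ(ζ)| = |ζ|^n`
with `n ≥ 2`, whence `|φ^m(ζ)| ≥ |a₀|^m` for `m ≥ 1` (`pow_le_abs_iterate`). The escape to `∞` is
uniform on `D`, which gives both the basin statement and equicontinuity.

If `|a₀| = 1`, every coefficient is `ν`-integral, and all iterates have coefficients in the
`ν`-integers of `K`. This ring is totally bounded because the quotients `𝓞 K / v^N` are finite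
(`totallyBounded_integralSubring`). On a disk of radius `r < 1` high powers of the variable are
negligible, so finitely many polynomials approximate all iterates uniformly
(`exists_finite_forall_seminorm_sub_le`). Each evaluation `ζ ↦ [f ∘ φ^m]_ζ` is then uniformly close
to one of finitely many continuous functions, an Arzelà–Ascoli argument
(`equicontinuousAt_map_of_totallyBounded`). -/

theorem abs_nonneg (ζ : BerkovichAffineLine F) : 0 ≤ ζ.abs := apply_nonneg ζ.seminorm X

@[simp]
theorem seminorm_map (φ f : F[X]) (ζ : BerkovichAffineLine F) :
    (map φ ζ).seminorm f = ζ.seminorm (f.comp φ) := rfl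

theorem abs_map (φ : F[X]) (ζ : BerkovichAffineLine F) : (map φ ζ).abs = ζ.seminorm φ := by
  simp [abs]

theorem continuous_map (φ : F[X]) : Continuous (map φ) :=
  isEmbedding_seminorm.continuous_iff.2 <| continuous_pi fun f => continuous_seminorm (f.comp φ)

theorem map_iterate (φ : F[X]) (m : ℕ) (ζ : BerkovichAffineLine F) :
    (map φ)^[m] ζ = map (φ.comp^[m] X) ζ := by
  induction m with
  | zero => ext f; simp
  | succ m ih =>
    rw [Function.iterate_succ_apply', Function.iterate_succ_apply', ih]
    ext f
    simp [comp_assoc]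

/-- A point of the Berkovich affine line over an ultrametric field is a nonarchimedean
seminorm. -/
theorem isNonarchimedean_seminorm [IsUltrametricDist F] (ζ : BerkovichAffineLine F) :
    IsNonarchimedean ζ.seminorm := by
  intro f g
  set M := max (ζ.seminorm f) (ζ.seminorm g) with hM
  have hM0 : 0 ≤ M := le_max_of_le_left (apply_nonneg _ _)
  -- Power trick: binomial coefficients have norm at most one, so the triangle inequality loses only
  -- a factor `k + 1`, which is negligible against an exponential as `k → ∞`.
  have hpow (k : ℕ) : ζ.seminorm (f + g) ^ k ≤ (k + 1) * M ^ k := by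
    rw [← map_pow, add_pow]
    refine (Finset.le_sum_of_subadditive _ (map_zero _).le (fun a b => map_add_le_add _ a b)
      _ _).trans ?_
    have hterm : ∀ i ∈ Finset.range (k + 1),
        ζ.seminorm (f ^ i * g ^ (k - i) * (k.choose i : F[X])) ≤ M ^ k := by
      intro i hi
      have hik : i + (k - i) = k := by have := Finset.mem_range.1 hi; omega
      have hc : ζ.seminorm (k.choose i : F[X]) ≤ 1 := by
        rw [← C_eq_natCast, ζ.map_C]
        exact IsUltrametricDist.norm_natCast_le_one F _
      rw [map_mul, map_mul, map_pow, map_pow]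
      calc _ ≤ M ^ i * M ^ (k - i) * 1 := by
            gcongr
            · exact le_max_left _ _
            · exact le_max_right _ _
        _ = M ^ k := by rw [mul_one, ← pow_add, hik]
    refine (Finset.sum_le_card_nsmul _ _ _ hterm).trans_eq ?_
    simp
  by_contra! hlt
  have hs : 0 < ζ.seminorm (f + g) := hM0.trans_lt hlt
  set t := M / ζ.seminorm (f + g) with ht
  have ht0 : 0 ≤ t := by positivity
  have ht1 : t < 1 := (div_lt_one hs).2 hlt
  have hlim : Tendsto (fun k : ℕ => ((k : ℝ) + 1) * t ^ k) atTop (𝓝 0) := by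
    have h1 := tendsto_self_mul_const_pow_of_lt_one ht0 ht1
    have h2 := tendsto_pow_atTop_nhds_zero_of_lt_one ht0 ht1
    simpa [add_mul] using h1.add h2
  refine absurd (ge_of_tendsto' hlim fun k => ?_) (not_le.2 one_pos)
  rw [ht, div_pow, ← mul_div_assoc, one_le_div (pow_pos hs k)]
  exact hpow k

/-- A family of maps into the Berkovich affine line whose values stay in a bounded disk is
equicontinuous as a family of maps into the projective line as soon as all its compositions with
the evaluations `ζ ↦ [f]_ζ` are. -/
theorem equicontinuousAt_coe {ι Y : Type*} [TopologicalSpace Y]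
    {G : ι → Y → BerkovichAffineLine F} {y : Y} {R : ℝ}
    (hR : ∀ᶠ z in 𝓝 y, ∀ i, (G i z).abs ≤ R)
    (h : ∀ f : F[X], EquicontinuousAt (fun i z => (G i z).seminorm f) y) :
    EquicontinuousAt (fun i z => (G i z : BerkovichProjectiveLine F)) y := by
  let _ : UniformSpace (BerkovichAffineLine F) :=
    UniformSpace.comap (fun ζ (f : F[X]) => ζ.seminorm f) inferInstance
  -- Compactness of the closed disk lets equicontinuity pass from the product uniformity of the
  -- evaluations to the abstract uniformity of the projective line.
  have hu : UniformContinuousOn (fun ζ : BerkovichAffineLine F => (ζ : BerkovichProjectiveLine F))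
      {ζ | ζ.abs ≤ R} :=
    (isCompact_abs_le R).uniformContinuousOn_of_continuous OnePoint.continuous_coe.continuousOn
  have hG : EquicontinuousAt G y := by
    have hind : IsUniformInducing (fun (ζ : BerkovichAffineLine F) (f : F[X]) => ζ.seminorm f) :=
      ⟨rfl⟩
    rw [hind.equicontinuousAt_iff, Pi.uniformSpace_eq, equicontinuousAt_iInf_rng]
    intro f U hU
    obtain ⟨V, hV, hVU⟩ := mem_comap.1 hU
    filter_upwards [h f V hV] with z hz i using hVU (hz i)
  intro U hU
  have hV := hu hU
  rw [mem_map, mem_inf_principal] at hV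
  filter_upwards [hG _ hV, hR] with z hz hzR i
  exact hz i ⟨hR.self_of_nhds i, hzR i⟩

/-- Composition with a fixed polynomial is Lipschitz on bounded sets, uniformly in the point of
the Berkovich affine line. -/
theorem exists_seminorm_comp_sub_le (f : F[X]) {R : ℝ} (hR : 0 ≤ R) :
    ∃ L, 0 ≤ L ∧ ∀ (ζ : BerkovichAffineLine F) (g h : F[X]), ζ.seminorm g ≤ R →
      ζ.seminorm h ≤ R → ζ.seminorm (f.comp g - f.comp h) ≤ L * ζ.seminorm (g - h) := by
  induction f using Polynomial.induction_on with
  | C a => exact ⟨0, le_rfl, by simp⟩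
  | add p q hp hq =>
    obtain ⟨L, hL, hp⟩ := hp
    obtain ⟨M, hM, hq⟩ := hq
    refine ⟨L + M, by positivity, fun ζ g h hg hh => ?_⟩
    rw [add_comp, add_comp, add_sub_add_comm, add_mul]
    exact (map_add_le_add _ _ _).trans (add_le_add (hp ζ g h hg hh) (hq ζ g h hg hh))
  | monomial k a ih =>
    obtain ⟨L, hL, ih⟩ := ih
    refine ⟨‖a‖ * R ^ k + L * R, by positivity, fun ζ g h hg hh => ?_⟩
    have key : (C a * X ^ (k + 1)).comp g - (C a * X ^ (k + 1)).comp h =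
        C a * g ^ k * (g - h) + ((C a * X ^ k).comp g - (C a * X ^ k).comp h) * h := by
      simp
      ring
    rw [key, add_mul]
    refine (map_add_le_add _ _ _).trans (add_le_add ?_ ?_)
    · rw [map_mul, map_mul, map_pow, ζ.map_C]
      gcongr
    · rw [map_mul, mul_right_comm]
      have := ih ζ g h hg hh
      gcongr

theorem abs_seminorm_sub_le (ζ : BerkovichAffineLine F) (f g : F[X]) :
    |ζ.seminorm f - ζ.seminorm g| ≤ ζ.seminorm (f - g) := abs_sub_map_le_sub ζ.seminorm f g

end BerkovichAffineLine

/-! ### Polynomials with totally bounded coefficients; growth near infinity -/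

namespace BerkovichAffineLine

variable {F : Type*} [NormedField F]

theorem seminorm_le_sum_range (ζ : BerkovichAffineLine F) {r : ℝ} (hr : ζ.abs ≤ r) {f : F[X]}
    {M : ℕ} (hM : f.natDegree < M) :
    ζ.seminorm f ≤ ∑ i ∈ Finset.range M, ‖f.coeff i‖ * r ^ i := by
  have hr0 : 0 ≤ r := ζ.abs_nonneg.trans hr
  refine (ζ.seminorm_le hr f).trans (Finset.sum_le_sum_of_subset_of_nonneg
    (fun i hi => Finset.mem_range.2 ((le_natDegree_of_mem_supp i hi).trans_lt hM))
    fun i _ _ => by positivity)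

theorem seminorm_le_of_norm_coeff_le_one (ζ : BerkovichAffineLine F) {r : ℝ} (hr : ζ.abs ≤ r)
    (hr1 : r < 1) {f : F[X]} (hf : ∀ i, ‖f.coeff i‖ ≤ 1) : ζ.seminorm f ≤ (1 - r)⁻¹ := by
  have hr0 : 0 ≤ r := ζ.abs_nonneg.trans hr
  have hgeom := geom_sum_Ico_le_of_lt_one (m := 0) (n := f.natDegree + 1) hr0 hr1
  rw [pow_zero, one_div, ← Finset.range_eq_Ico] at hgeom
  refine (ζ.seminorm_le_sum_range hr (Nat.lt_succ_self _)).trans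
    ((Finset.sum_le_sum fun i _ => ?_).trans hgeom)
  exact mul_le_of_le_one_left (by positivity) (hf i)

/-- On a closed disk of radius `r < 1`, the polynomials with coefficients in a totally bounded
set of elements of norm at most one are uniformly approximated by finitely many of them. -/
theorem exists_finite_forall_seminorm_sub_le {S : Set F} (hS : TotallyBounded S)
    (hS1 : ∀ s ∈ S, ‖s‖ ≤ 1) {r : ℝ} (hr0 : 0 ≤ r) (hr1 : r < 1) {δ : ℝ} (hδ : 0 < δ) :
    ∃ T : Set F[X], T.Finite ∧ ∀ g : F[X], (∀ i, g.coeff i ∈ S) →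
      ∃ h ∈ T, ∀ ζ : BerkovichAffineLine F, ζ.abs ≤ r → ζ.seminorm (g - h) ≤ δ := by
  -- The tail from degree `N` on is at most `r ^ N / (1 - r) < δ / 2`; the `N` lower coefficients
  -- share the other `δ / 2`.
  obtain ⟨N, hN⟩ := exists_pow_lt_of_lt_one (mul_pos (half_pos hδ) (sub_pos.2 hr1)) hr1
  have hε : 0 < δ / 2 / (N + 1) := by positivity
  obtain ⟨t, ht, hSt⟩ := Metric.totallyBounded_iff.1 hS _ hε
  refine ⟨(fun c : Fin N → F => ∑ i, C (c i) * X ^ (i : ℕ)) '' Set.univ.pi fun _ => t,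
    (Set.Finite.pi fun _ => ht).image _, fun g hg => ?_⟩
  have hex (i : Fin N) : ∃ c ∈ t, ‖g.coeff i - c‖ < δ / 2 / (N + 1) := by
    simpa [dist_eq_norm] using hSt (hg i)
  choose c hct hc using hex
  refine ⟨_, ⟨c, fun i _ => hct i, rfl⟩, fun ζ hζ => ?_⟩
  dsimp only
  set p : F[X] := g - ∑ i, C (c i) * X ^ (i : ℕ) with hp
  have hcoeff_lt (i : ℕ) (hi : i < N) : ‖p.coeff i‖ ≤ δ / 2 / (N + 1) := by
    have : p.coeff i = g.coeff i - c ⟨i, hi⟩ := by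
      rw [hp, coeff_sub, finsetSum_coeff, Finset.sum_eq_single ⟨i, hi⟩]
      · simp
      · intro j _ hj
        have : i ≠ j := fun h => hj (Fin.ext h.symm)
        simp [coeff_X_pow, this]
      · simp
    rw [this]
    exact (hc ⟨i, hi⟩).le
  have hcoeff_ge (i : ℕ) (hi : N ≤ i) : ‖p.coeff i‖ ≤ 1 := by
    have : p.coeff i = g.coeff i := by
      rw [hp, coeff_sub, finsetSum_coeff, Finset.sum_eq_zero, sub_zero]
      intro j _
      have : i ≠ j := (j.2.trans_le hi).ne'
      simp [coeff_X_pow, this]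
    rw [this]
    exact hS1 _ (hg i)
  have hM : N ≤ max N (p.natDegree + 1) := le_max_left _ _
  refine (ζ.seminorm_le_sum_range hζ
    (M := max N (p.natDegree + 1)) (Nat.lt_of_succ_le (le_max_right _ _))).trans ?_
  rw [← Finset.sum_range_add_sum_Ico _ hM]
  have h1 : ∑ i ∈ Finset.range N, ‖p.coeff i‖ * r ^ i ≤ δ / 2 := by
    have hterm : ∀ i ∈ Finset.range N, ‖p.coeff i‖ * r ^ i ≤ δ / 2 / (N + 1) := fun i hi =>
      (mul_le_of_le_one_right (norm_nonneg _) (pow_le_one₀ hr0 hr1.le)).trans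
        (hcoeff_lt i (Finset.mem_range.1 hi))
    refine (Finset.sum_le_card_nsmul _ _ _ hterm).trans ?_
    rw [Finset.card_range, nsmul_eq_mul, mul_div_assoc', div_le_iff₀ (by positivity)]
    nlinarith
  have h2 : ∑ i ∈ Finset.Ico N (max N (p.natDegree + 1)), ‖p.coeff i‖ * r ^ i ≤ δ / 2 := by
    refine (Finset.sum_le_sum fun i hi => ?_).trans
      ((geom_sum_Ico_le_of_lt_one hr0 hr1).trans ((div_le_iff₀ (sub_pos.2 hr1)).2 hN.le))
    exact mul_le_of_le_one_left (by positivity) (hcoeff_ge i (Finset.mem_Ico.1 hi).1)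
  linarith

/-- Polynomials with coefficients in a totally bounded set of elements of norm at most one act
equicontinuously on the open unit disk. -/
theorem equicontinuousAt_map_of_totallyBounded {S : Set F} (hS : TotallyBounded S)
    (hS1 : ∀ s ∈ S, ‖s‖ ≤ 1) {ι : Type*} {g : ι → F[X]} (hg : ∀ i k, (g i).coeff k ∈ S)
    {ζ₀ : BerkovichAffineLine F} (hζ₀ : ζ₀.abs < 1) :
    EquicontinuousAt (fun i ζ => (map (g i) ζ : BerkovichProjectiveLine F)) ζ₀ := by
  obtain ⟨r, hr, hr1⟩ := exists_between hζ₀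
  have hr0 : 0 ≤ r := ζ₀.abs_nonneg.trans hr.le
  have hev : ∀ᶠ ζ : BerkovichAffineLine F in 𝓝 ζ₀, ζ.abs ≤ r :=
    mem_of_superset ((isOpen_lt (continuous_seminorm X) continuous_const).mem_nhds hr)
      fun ζ (h : ζ.abs < r) => h.le
  have hbound (ζ : BerkovichAffineLine F) (hζ : ζ.abs ≤ r) (i : ι) :
      ζ.seminorm (g i) ≤ (1 - r)⁻¹ :=
    ζ.seminorm_le_of_norm_coeff_le_one hζ hr1 fun k => hS1 _ (hg i k)
  refine equicontinuousAt_coe (R := (1 - r)⁻¹) (hev.mono fun ζ hζ i => ?_) fun f => ?_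
  · rw [abs_map]
    exact hbound ζ hζ i
  rw [Metric.equicontinuousAt_iff_right]
  intro ε hε
  have hinv : 0 < (1 - r)⁻¹ := inv_pos.2 (sub_pos.2 hr1)
  -- The radius leaves room for the approximants, which lie within `1` of some `g i`. Below, `L + 1`
  -- avoids dividing by zero.
  obtain ⟨L, hL, hLip⟩ := exists_seminorm_comp_sub_le f (R := (1 - r)⁻¹ + 1) (by positivity)
  have hδ : 0 < min 1 (ε / 3 / (L + 1)) := by positivity
  obtain ⟨T, hT, hTg⟩ := exists_finite_forall_seminorm_sub_le hS hS1 hr0 hr1 hδ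
  have hevT : ∀ᶠ ζ : BerkovichAffineLine F in 𝓝 ζ₀, ∀ h ∈ T,
      |ζ₀.seminorm (f.comp h) - ζ.seminorm (f.comp h)| < ε / 3 := by
    refine (eventually_all_finite hT).2 fun h _ => ?_
    have := (continuous_seminorm (f.comp h)).continuousAt.eventually
      (Metric.ball_mem_nhds (ζ₀.seminorm (f.comp h)) (by positivity : 0 < ε / 3))
    filter_upwards [this] with ζ hζ
    rwa [Real.dist_eq, abs_sub_comm] at hζ
  filter_upwards [hev, hevT] with ζ hζ hζT i
  obtain ⟨h, hhT, hh⟩ := hTg (g i) (hg i)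
  have happrox (ξ : BerkovichAffineLine F) (hξ : ξ.abs ≤ r) :
      |ξ.seminorm (f.comp (g i)) - ξ.seminorm (f.comp h)| ≤ ε / 3 := by
    have h1 := hh ξ hξ
    have h2 := hbound ξ hξ i
    have h3 : ξ.seminorm h ≤ (1 - r)⁻¹ + 1 := by
      have := map_sub_le_add ξ.seminorm (g i) (g i - h)
      rw [sub_sub_cancel] at this
      linarith [h1.trans (min_le_left _ _)]
    refine (ξ.abs_seminorm_sub_le _ _).trans ((hLip ξ _ _ (by linarith) h3).trans ?_)
    have h4 := h1.trans (min_le_right _ _)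
    rw [le_div_iff₀ (by positivity)] at h4
    nlinarith [apply_nonneg ξ.seminorm (g i - h)]
  have e1 := abs_le.1 (happrox ζ₀ hr.le)
  have e2 := abs_le.1 (happrox ζ hζ)
  have e3 := abs_lt.1 (hζT h hhT)
  rw [Real.dist_eq, abs_lt, seminorm_map, seminorm_map]
  constructor <;> linarith

/-- A net of points whose absolute values tend to `+∞` converges to `∞`. -/
theorem tendsto_coe_nhds_infty :
    Tendsto (fun ζ : BerkovichAffineLine F => (ζ : BerkovichProjectiveLine F))
      (comap abs atTop) (𝓝 ∞) := by
  refine OnePoint.tendsto_coe_infty.mono_left ?_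
  rw [hasBasis_coclosedCompact.ge_iff]
  rintro s ⟨-, hs⟩
  obtain ⟨B, hB⟩ := (hs.image (continuous_seminorm (F := F) X)).bddAbove
  refine mem_comap.2 ⟨Set.Ioi B, Ioi_mem_atTop B, fun ζ hζ hmem => ?_⟩
  exact absurd (hB ⟨ζ, hmem, rfl⟩) (not_le.2 hζ)

section Escape

variable [IsUltrametricDist F] {φ : F[X]}

theorem seminorm_eq_norm_coeff_zero (hmonic : φ.Monic) (h0 : 1 < ‖φ.coeff 0‖)
    (hlt : ∀ i, 0 < i → i < φ.natDegree → ‖φ.coeff i‖ < ‖φ.coeff 0‖)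
    {ζ : BerkovichAffineLine F} (hζ : ζ.abs < 1) : ζ.seminorm φ = ‖φ.coeff 0‖ := by
  have hterm (i : ℕ) : ζ.seminorm (C (φ.coeff i) * X ^ i) = ‖φ.coeff i‖ * ζ.abs ^ i := by
    rw [map_mul, map_pow, ζ.map_C, abs]
  have key := ζ.isNonarchimedean_seminorm.apply_sum_eq_of_lt (fun a => (map_neg_eq_map _ a).symm)
    (s := Finset.range (φ.natDegree + 1)) (l := fun i => C (φ.coeff i) * X ^ i) (k := 0)
    (by simp) ?_
  · rw [← φ.as_sum_range_C_mul_X_pow, hterm] at key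
    simpa using key
  · intro i hi hi0
    rw [hterm, hterm, pow_zero, mul_one]
    refine (mul_le_of_le_one_right (norm_nonneg _)
      (pow_le_one₀ ζ.abs_nonneg hζ.le)).trans_lt ?_
    rcases (Nat.lt_succ_iff.1 (Finset.mem_range.1 hi)).lt_or_eq with hin | rfl
    · exact hlt i (Nat.pos_of_ne_zero hi0) hin
    · rwa [hmonic.coeff_natDegree, norm_one]

/-- The leading term strictly dominates: for `0 < i < n`, `|aᵢ| < |a₀| ≤ |ζ|` gives `|aᵢ||ζ|^i <
|ζ|^(i+1) ≤ |ζ|^n`, while `|a₀| ≤ |ζ| < |ζ|^n` because `n ≥ 2`. -/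
theorem seminorm_eq_abs_pow_natDegree (hmonic : φ.Monic) (hdeg : 2 ≤ φ.natDegree)
    (h0 : 1 < ‖φ.coeff 0‖)
    (hlt : ∀ i, 0 < i → i < φ.natDegree → ‖φ.coeff i‖ < ‖φ.coeff 0‖)
    {ζ : BerkovichAffineLine F} (hζ : ‖φ.coeff 0‖ ≤ ζ.abs) :
    ζ.seminorm φ = ζ.abs ^ φ.natDegree := by
  have h1 : 1 < ζ.abs := h0.trans_le hζ
  have hterm (i : ℕ) : ζ.seminorm (C (φ.coeff i) * X ^ i) = ‖φ.coeff i‖ * ζ.abs ^ i := by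
    rw [map_mul, map_pow, ζ.map_C, abs]
  have key := ζ.isNonarchimedean_seminorm.apply_sum_eq_of_lt (fun a => (map_neg_eq_map _ a).symm)
    (s := Finset.range (φ.natDegree + 1)) (l := fun i => C (φ.coeff i) * X ^ i)
    (k := φ.natDegree) (by simp) ?_
  · rw [← φ.as_sum_range_C_mul_X_pow, hterm] at key
    simpa [hmonic.coeff_natDegree] using key
  · intro i hi hin
    have hin : i < φ.natDegree :=
      lt_of_le_of_ne (Nat.lt_succ_iff.1 (Finset.mem_range.1 hi)) hin
    rw [hterm, hterm, hmonic.coeff_natDegree, norm_one, one_mul]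
    rcases Nat.eq_zero_or_pos i with rfl | hi0
    · rw [pow_zero, mul_one]
      exact hζ.trans_lt (lt_self_pow₀ h1 (by omega))
    · calc ‖φ.coeff i‖ * ζ.abs ^ i < ζ.abs * ζ.abs ^ i := by
            have := (hlt i hi0 hin).trans_le hζ
            gcongr
        _ = ζ.abs ^ (i + 1) := (pow_succ' _ _).symm
        _ ≤ ζ.abs ^ φ.natDegree := pow_le_pow_right₀ h1.le hin

theorem pow_le_abs_iterate (hmonic : φ.Monic) (hdeg : 2 ≤ φ.natDegree)
    (h0 : 1 < ‖φ.coeff 0‖)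
    (hlt : ∀ i, 0 < i → i < φ.natDegree → ‖φ.coeff i‖ < ‖φ.coeff 0‖)
    {ζ : BerkovichAffineLine F} (hζ : ζ.abs < 1) (m : ℕ) :
    ‖φ.coeff 0‖ ^ (m + 1) ≤ ((map φ)^[m + 1] ζ).abs := by
  induction m with
  | zero =>
    rw [Function.iterate_succ_apply', abs_map, Function.iterate_zero, id,
      seminorm_eq_norm_coeff_zero hmonic h0 hlt hζ, zero_add, pow_one]
  | succ m ih =>
    have h1 : ‖φ.coeff 0‖ ≤ ((map φ)^[m + 1] ζ).abs :=
      (le_self_pow₀ h0.le m.succ_ne_zero).trans ih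
    rw [Function.iterate_succ_apply', abs_map,
      seminorm_eq_abs_pow_natDegree hmonic hdeg h0 hlt h1]
    calc ‖φ.coeff 0‖ ^ (m + 1 + 1) = ‖φ.coeff 0‖ ^ (m + 1) * ‖φ.coeff 0‖ := pow_succ _ _
      _ ≤ ((map φ)^[m + 1] ζ).abs * ((map φ)^[m + 1] ζ).abs :=
        mul_le_mul ih h1 (norm_nonneg _) (abs_nonneg _)
      _ = ((map φ)^[m + 1] ζ).abs ^ 2 := (sq _).symm
      _ ≤ _ := pow_le_pow_right₀ (h0.le.trans h1) hdeg

/-- The iterates of `φ` converge to `∞` uniformly on the open unit disk. -/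
theorem eventually_forall_iterate_mem (hmonic : φ.Monic) (hdeg : 2 ≤ φ.natDegree)
    (h0 : 1 < ‖φ.coeff 0‖)
    (hlt : ∀ i, 0 < i → i < φ.natDegree → ‖φ.coeff i‖ < ‖φ.coeff 0‖)
    {W : Set (BerkovichProjectiveLine F)} (hW : W ∈ 𝓝 ∞) :
    ∀ᶠ m in atTop, ∀ ζ : BerkovichAffineLine F, ζ.abs < 1 →
      (((map φ)^[m + 1] ζ : BerkovichAffineLine F) : BerkovichProjectiveLine F) ∈ W := by
  obtain ⟨V, hV, hVW⟩ := mem_comap.1 (tendsto_coe_nhds_infty hW)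
  obtain ⟨B, hB⟩ := mem_atTop_sets.1 hV
  have hpow := ((tendsto_pow_atTop_atTop_of_one_lt h0).comp (tendsto_add_atTop_nat 1)).eventually
    (eventually_ge_atTop B)
  filter_upwards [hpow] with m hm ζ hζ
  exact hVW (hB _ (hm.trans (pow_le_abs_iterate hmonic hdeg h0 hlt hζ m)))

end Escape

end BerkovichAffineLine

/-! ### The unit disk in the Fatou set and in the basin of infinity -/

namespace BerkovichProjectiveLine

variable {F : Type*} [NormedField F]

theorem map_iterate_coe (φ : F[X]) (m : ℕ) (ζ : BerkovichAffineLine F) :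
    (map φ)^[m] (ζ : BerkovichProjectiveLine F) =
      ((BerkovichAffineLine.map φ)^[m] ζ : BerkovichAffineLine F) := by
  induction m generalizing ζ with
  | zero => rfl
  | succ m ih => exact ih (BerkovichAffineLine.map φ ζ)

theorem isOpen_openUnitDisk : IsOpen (openUnitDisk F) :=
  OnePoint.isOpenEmbedding_coe.isOpenMap _
    (isOpen_lt (BerkovichAffineLine.continuous_seminorm X) continuous_const)

/-- The affine line is open in the projective line, so equicontinuity at an affine point can be
tested on affine neighbourhoods. -/
theorem openUnitDisk_subset_fatouSet {φ : F[X]}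
    (h : ∀ ζ₀ : BerkovichAffineLine F, ζ₀.abs < 1 → EquicontinuousAt (fun (m : ℕ) ζ =>
      (((BerkovichAffineLine.map φ)^[m + 1] ζ : BerkovichAffineLine F) :
        BerkovichProjectiveLine F)) ζ₀) :
    openUnitDisk F ⊆ fatouSet φ := by
  refine Set.subset_sUnion_of_mem ⟨isOpen_openUnitDisk, ?_⟩
  rintro _ ⟨ζ₀, hζ₀, rfl⟩
  refine EquicontinuousAt.equicontinuousWithinAt (fun U hU => ?_) _
  rw [OnePoint.nhds_coe_eq, eventually_map]
  filter_upwards [h ζ₀ hζ₀ U hU] with ζ hζ m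
  rw [map_iterate_coe, map_iterate_coe]
  exact hζ m

/-- A polynomial with coefficients in a totally bounded subring of the unit ball has the open unit
disk in its Fatou set. -/
theorem openUnitDisk_subset_fatouSet_of_totallyBounded {S : Subring F}
    (hS : TotallyBounded (S : Set F)) (hS1 : ∀ s ∈ S, ‖s‖ ≤ 1) {φ : F[X]}
    (hφ : ∀ i, φ.coeff i ∈ S) : openUnitDisk F ⊆ fatouSet φ := by
  refine openUnitDisk_subset_fatouSet fun ζ₀ hζ₀ => ?_
  simp only [BerkovichAffineLine.map_iterate]
  refine BerkovichAffineLine.equicontinuousAt_map_of_totallyBounded hS hS1 (fun m => ?_) hζ₀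
  have hmem (p : F[X]) : p ∈ lifts S.subtype ↔ ∀ k, p.coeff k ∈ (S : Set F) := by
    simp [lifts_iff_coeff_lifts]
  -- `φ` lifts to `S[X]`, and composition commutes with the coefficient map, so all iterates lift
  -- too.
  refine (hmem _).1 ?_
  obtain ⟨ψ, rfl⟩ := (mem_lifts _).1 ((hmem φ).2 hφ)
  refine (mem_lifts _).2 ⟨ψ.comp^[m + 1] X, ?_⟩
  generalize m + 1 = k
  induction k with
  | zero => simp
  | succ k ih => rw [Function.iterate_succ_apply', Function.iterate_succ_apply', map_comp, ih]

section Escape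

variable [IsUltrametricDist F] {φ : F[X]}

theorem openUnitDisk_subset_basinOfInfinity (hmonic : φ.Monic) (hdeg : 2 ≤ φ.natDegree)
    (h0 : 1 < ‖φ.coeff 0‖)
    (hlt : ∀ i, 0 < i → i < φ.natDegree → ‖φ.coeff i‖ < ‖φ.coeff 0‖) :
    openUnitDisk F ⊆ basinOfInfinity φ := by
  rintro _ ⟨ζ, hζ, rfl⟩
  refine (tendsto_add_atTop_iff_nat 1).1 fun W hW => mem_map.2 ?_
  filter_upwards [BerkovichAffineLine.eventually_forall_iterate_mem hmonic hdeg h0 hlt hW]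
    with m hm
  rw [Set.mem_preimage, map_iterate_coe]
  exact hm ζ hζ

/-- Beyond some `M` all iterates on the disk are close to `∞`, hence to each other; the finitely
many earlier ones are continuous. -/
theorem openUnitDisk_subset_fatouSet_of_one_lt (hmonic : φ.Monic) (hdeg : 2 ≤ φ.natDegree)
    (h0 : 1 < ‖φ.coeff 0‖)
    (hlt : ∀ i, 0 < i → i < φ.natDegree → ‖φ.coeff i‖ < ‖φ.coeff 0‖) :
    openUnitDisk F ⊆ fatouSet φ := by
  refine openUnitDisk_subset_fatouSet fun ζ₀ hζ₀ U hU => ?_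
  obtain ⟨V, hV, hsymm, hVU⟩ := comp_symm_mem_uniformity_sets hU
  obtain ⟨M, hM⟩ := eventually_atTop.1
    (BerkovichAffineLine.eventually_forall_iterate_mem hmonic hdeg h0 hlt
      (UniformSpace.ball_mem_nhds ∞ hV))
  have hcont : ∀ᶠ ζ in 𝓝 ζ₀, ∀ m ∈ Set.Iio M,
      ((((BerkovichAffineLine.map φ)^[m + 1] ζ₀ : BerkovichAffineLine F) :
        BerkovichProjectiveLine F), (((BerkovichAffineLine.map φ)^[m + 1] ζ :
          BerkovichAffineLine F) : BerkovichProjectiveLine F)) ∈ U :=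
    (eventually_all_finite (Set.finite_Iio M)).2 fun m _ =>
      (OnePoint.continuous_coe.comp
        ((BerkovichAffineLine.continuous_map φ).iterate (m + 1))).continuousAt.eventually
        (UniformSpace.ball_mem_nhds _ hU)
  have hdisk : ∀ᶠ ζ : BerkovichAffineLine F in 𝓝 ζ₀, ζ.abs < 1 :=
    (isOpen_lt (BerkovichAffineLine.continuous_seminorm X) continuous_const).mem_nhds hζ₀
  filter_upwards [hcont, hdisk] with ζ hζ hζ1 m
  rcases lt_or_ge m M with hm | hm
  · exact hζ m hm
  · exact hVU ⟨∞, UniformSpace.mem_ball_symmetry.1 (hM m hm ζ₀ hζ₀), hM m hm ζ hζ1⟩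

end Escape

end BerkovichProjectiveLine

/-! ### Norm and integers of `K` inside `ℂ_ν` -/

namespace FinitePlaceComplex

variable {K : Type*} [Field K] [NumberField K] (v : HeightOneSpectrum (𝓞 K))

theorem norm_embedding (x : K) :
    ‖embedding v x‖ = WithZeroMulInt.toNNReal
      (NumberField.HeightOneSpectrum.absNorm_ne_zero v) (v.valuation K x) := by
  change ‖((algebraMap (v.adicCompletion K) (AlgCl v)
    (algebraMap K (v.adicCompletion K) x) : AlgCl v) : Cv v)‖ = _
  rw [UniformSpace.Completion.norm_coe]
  refine (spectralNorm_extends (L := AlgCl v) (algebraMap K (v.adicCompletion K) x)).trans ?_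
  rw [← v.valuedAdicCompletion_eq_valuation' x]
  exact NumberField.FinitePlace.norm_def v _

theorem strictMono_toNNReal_absNorm : StrictMono (WithZeroMulInt.toNNReal
    (NumberField.HeightOneSpectrum.absNorm_ne_zero v)) :=
  WithZeroMulInt.toNNReal_strictMono (NumberField.HeightOneSpectrum.one_lt_absNorm_nnreal v)

theorem norm_embedding_lt_iff {x y : K} :
    ‖embedding v x‖ < ‖embedding v y‖ ↔ v.valuation K x < v.valuation K y := by
  rw [norm_embedding, norm_embedding, NNReal.coe_lt_coe,
    (strictMono_toNNReal_absNorm v).lt_iff_lt]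

theorem norm_embedding_le_one_iff {x : K} : ‖embedding v x‖ ≤ 1 ↔ v.valuation K x ≤ 1 := by
  rw [← not_lt, ← not_lt, ← norm_one (α := Cv v), ← map_one (embedding v),
    norm_embedding_lt_iff, map_one]

instance instIsUltrametricDistAlgCl : IsUltrametricDist (AlgCl v) :=
  IsUltrametricDist.isUltrametricDist_of_isNonarchimedean_norm
    (isNonarchimedean_spectralNorm (K := v.adicCompletion K) (L := AlgCl v))

instance instIsUltrametricDistCv : IsUltrametricDist (Cv v) := by
  refine IsUltrametricDist.isUltrametricDist_of_isNonarchimedean_norm fun x y => ?_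
  induction x, y using UniformSpace.Completion.induction_on₂ with
  | hp => exact isClosed_le (by fun_prop) (by fun_prop)
  | ih a b =>
    rw [← UniformSpace.Completion.coe_add]
    simp only [UniformSpace.Completion.norm_coe]
    exact IsUltrametricDist.isNonarchimedean_norm a b

/-- The image in `ℂ_ν` of the ring of `ν`-integral elements of `K`. -/
noncomputable def integralSubring : Subring (Cv v) := (v.valuation K).integer.map (embedding v)

theorem norm_le_one_of_mem_integralSubring {s : Cv v} (hs : s ∈ integralSubring v) : ‖s‖ ≤ 1 := by
  obtain ⟨x, hx, rfl⟩ := hs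
  exact (norm_embedding_le_one_iff v).2 hx

theorem totallyBounded_integralSubring : TotallyBounded (integralSubring v : Set (Cv v)) := by
  rw [Metric.totallyBounded_iff]
  intro ε hε
  obtain ⟨π, hπ⟩ := v.valuation_exists_uniformizer K
  have hπ1 : ‖embedding v π‖ < 1 := by
    rw [← norm_one (α := Cv v), ← map_one (embedding v), norm_embedding_lt_iff, hπ, map_one]
    rw [← WithZero.exp_zero, WithZero.exp_lt_exp]
    norm_num
  obtain ⟨N, hN⟩ := exists_pow_lt_of_lt_one hε hπ1
  rw [← norm_pow, ← map_pow] at hN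
  have hval : v.valuation K (π ^ N) = WithZero.exp (-(N : ℤ)) := by
    rw [map_pow, hπ, ← WithZero.exp_nsmul]
    simp
  have : Finite (𝓞 K ⧸ v.asIdeal ^ N) :=
    Ideal.finiteQuotientOfFreeOfNeBot _ (pow_ne_zero N v.ne_bot)
  -- The centres are representatives of `𝓞 K / v^N`. A `ν`-integral `x` is first approximated by
  -- some `a` in `𝓞 K`, then `a` is replaced by the representative of its class; both errors have
  -- norm at most `‖π ^ N‖ < ε`.
  refine ⟨Set.range fun q : 𝓞 K ⧸ v.asIdeal ^ N =>
    embedding v (algebraMap (𝓞 K) K q.out), Set.finite_range _, ?_⟩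
  rintro _ ⟨x, hx, rfl⟩
  obtain ⟨a, ha⟩ := v.exists_valuation_sub_lt_of_integer hx
    (Units.mk0 (WithZero.exp (-(N : ℤ))) WithZero.exp_ne_zero)
  set b : 𝓞 K := (Ideal.Quotient.mk (v.asIdeal ^ N) a).out with hb
  have hab : v.valuation K (algebraMap (𝓞 K) K (a - b)) ≤ WithZero.exp (-(N : ℤ)) := by
    rw [HeightOneSpectrum.valuation_of_algebraMap, HeightOneSpectrum.intValuation_le_pow_iff_mem,
      ← Ideal.Quotient.eq]
    exact (Ideal.Quotient.mk_out _).symm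
  refine Set.mem_iUnion₂.2 ⟨_, ⟨Ideal.Quotient.mk (v.asIdeal ^ N) a, rfl⟩, ?_⟩
  rw [Metric.mem_ball, dist_eq_norm]
  change ‖embedding v x - embedding v (algebraMap (𝓞 K) K b)‖ < ε
  rw [← map_sub]
  refine lt_of_le_of_lt ?_ hN
  rw [← not_lt, norm_embedding_lt_iff, not_lt, hval]
  have hsplit : x - algebraMap (𝓞 K) K b =
      -(algebraMap (𝓞 K) K a - x) + algebraMap (𝓞 K) K (a - b) := by
    rw [map_sub]
    ring
  rw [hsplit]
  exact Valuation.map_add_le _ (by rw [Valuation.map_neg]; exact ha.le) hab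

end FinitePlaceComplex

/-! ### The main theorem -/

theorem lemma3p1 {K : Type*} [Field K] [NumberField K] (v : HeightOneSpectrum (𝓞 K))
    (n : ℕ) (hn : 2 ≤ n) (φ : K[X]) (hmonic : φ.Monic) (hdeg : φ.natDegree = n)
    -- Mathlib's valuation is multiplicative, which reverses the order of the additive `ν`
    (h₀ : 1 ≤ v.valuation K (φ.coeff 0))
    (hlt : ∀ i, 0 < i → i < n → v.valuation K (φ.coeff i) < v.valuation K (φ.coeff 0)) :
    Disjoint (BerkovichProjectiveLine.juliaSet (φ.map (FinitePlaceComplex.embedding v)))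
        (BerkovichProjectiveLine.openUnitDisk (FinitePlaceComplex.Cv v)) ∧
      (1 < v.valuation K (φ.coeff 0) →
        BerkovichProjectiveLine.openUnitDisk (FinitePlaceComplex.Cv v) ⊆
          BerkovichProjectiveLine.basinOfInfinity
            (φ.map (FinitePlaceComplex.embedding v))) := by
  subst hdeg
  have hmonic' : (φ.map (FinitePlaceComplex.embedding v)).Monic := hmonic.map _
  have hdeg' : (φ.map (FinitePlaceComplex.embedding v)).natDegree = φ.natDegree :=
    natDegree_map _
  have hlt' : ∀ i, 0 < i → i < (φ.map (FinitePlaceComplex.embedding v)).natDegree →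
      ‖(φ.map (FinitePlaceComplex.embedding v)).coeff i‖ <
        ‖(φ.map (FinitePlaceComplex.embedding v)).coeff 0‖ := by
    intro i hi hin
    rw [coeff_map, coeff_map, FinitePlaceComplex.norm_embedding_lt_iff]
    exact hlt i hi (hdeg' ▸ hin)
  have hone (h : 1 < v.valuation K (φ.coeff 0)) :
      1 < ‖(φ.map (FinitePlaceComplex.embedding v)).coeff 0‖ := by
    rwa [coeff_map, ← not_le, FinitePlaceComplex.norm_embedding_le_one_iff, not_le]
  refine ⟨Set.disjoint_compl_left_iff_subset.2 ?_, fun h =>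
    BerkovichProjectiveLine.openUnitDisk_subset_basinOfInfinity hmonic' (hdeg'.symm ▸ hn)
      (hone h) hlt'⟩
  rcases h₀.lt_or_eq with h | h
  · exact BerkovichProjectiveLine.openUnitDisk_subset_fatouSet_of_one_lt hmonic'
      (hdeg'.symm ▸ hn) (hone h) hlt'
  -- Here `a₀` is a unit at `v`, so the domination hypothesis makes all coefficients integral.
  · refine BerkovichProjectiveLine.openUnitDisk_subset_fatouSet_of_totallyBounded
      (FinitePlaceComplex.totallyBounded_integralSubring v)
      (fun s => FinitePlaceComplex.norm_le_one_of_mem_integralSubring v) fun i => ?_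
    rw [coeff_map]
    refine ⟨_, ?_, rfl⟩
    change v.valuation K (φ.coeff i) ≤ 1
    rcases lt_trichotomy i φ.natDegree with hi | rfl | hi
    · rcases Nat.eq_zero_or_pos i with rfl | hi0
      · exact h.ge
      · exact (hlt i hi0 hi).le.trans h.ge
    · rw [hmonic.coeff_natDegree, map_one]
    · rw [coeff_eq_zero_of_natDegree_lt hi, map_zero]
      exact zero_le_one
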